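/- Let $k$ be a field, $n\ge 2$, $r\ge 3n+2$ and $s=r(3n+2)+3$. Let $\mathfrak{P}_{nr}\subset k[x_1,x_2,x_3,x_4]$ be the kernel of the $k$-algebra homomorphism $k[x_1,\dots,x_4]\to k[t]$ with $x_1\mapsto t^{s}$, $x_2\mapsto t^{s+3}$, $x_3\mapsto t^{s+3n+1}$, $x_4\mapsto t^{s+3n+2}$. Put $$f_1=x_2x_3^3-x_1x_4^3,\qquad f_{2i}=x_1^{n-i}x_3^{3i-1}-x_2^{n-i+1}x_4^{3i-2}\ (1\le i\le n),$$ $$f_{3j}=x_1^{r-n+3+j}x_2^{n-1-j}-x_3^{2+3j}x_4^{r-1-3j},\qquad f_{4j}=x_1^{r-2n+3+j}x_2^{2n-j}-x_3^{3j+1}x_4^{r+1-3j}\ (0\le j\le n-1),$$ $$f_5=x_1^{r-n+2}x_2^nx_3-x_4^{r+2},\quad f_6=x_2^{n+1}x_3-x_1^nx_4^2,\quad f_7=x_2^{2n+1}-x_1^{2n-1}x_3x_4,\quad g=x_1^{r+2}-x_2x_4^r,$$ and let $G_{nr}=\big(\{f_1,f_{2i},f_{3j},f_{4j},f_5,f_6,f_7\mid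 1\le i\le n,\ 0\le j\le n-1\}\setminus\{f_{3(n-1)}\}\big)\cup\{g\}$. Then, with respect to the degree reverse lexicographic order with $x_1>x_2>x_3>x_4$, the set $G_{nr}$ is a Gröbner basis of $\mathfrak{P}_{nr}$. Moreover, the unique minimal set of monomial generators of the initial ideal $\mathrm{in}_<(\mathfrak{P}_{nr})$ is $$\{x_2x_3^3,\ x_1^{n-i}x_3^{3i-1},\ x_1^{r-n+3+j}x_2^{n-1-j},\ x_1^{r-2n+3+j}x_2^{2n-j},\ x_1^{r-n+2}x_2^nx_3,\ x_2^{n+1}x_3,\ x_2^{2n+1}\mid 1\le i\le n,\ 0\le j\le n-1\},$$ and none of these monomials is divisible by $x_4$. -/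

import Mathlib

noncomputable section

namespace Backelin

open MvPolynomial

/-! ### Degree reverse lexicographic order -/

/-- Exponent vectors in `m` variables, to be ordered degree-reverse-lexicographically. -/
def DegRevLex (m : ℕ) : Type := Fin m →₀ ℕ

namespace DegRevLex

instance (m : ℕ) : AddCommMonoid (DegRevLex m) :=
  inferInstanceAs (AddCommMonoid (Fin m →₀ ℕ))

/-- The identity map, as an additive equivalence. -/
def toDRL (m : ℕ) : (Fin m →₀ ℕ) ≃+ DegRevLex m := AddEquiv.refl _

/-- The comparison key: first the total degree, then the reversed colexicographic order
of the exponents. See `DegRevLex.lt_iff` for the explicit form of the order. -/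
def key {m : ℕ} (a : DegRevLex m) : ℕ ×ₗ (Colex (Fin m → ℕ))ᵒᵈ :=
  toLex (((toDRL m).symm a).degree, OrderDual.toDual (toColex ⇑((toDRL m).symm a)))

theorem key_injective (m : ℕ) : Function.Injective (key (m := m)) := by
  intro a b h
  have h2 := congrArg (fun p => ofColex (OrderDual.ofDual (ofLex p).2)) h
  exact (toDRL m).symm.injective (DFunLike.coe_injective h2)

instance (m : ℕ) : LinearOrder (DegRevLex m) := LinearOrder.lift' key (key_injective m)

/-- `a < b` iff `deg a < deg b`, or the degrees agree and at the last index where `a` and `b`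
differ the entry of `a` is the larger one. In particular `x₀ > x₁ > ⋯`. -/
theorem lt_iff {m : ℕ} (a b : Fin m →₀ ℕ) :
    toDRL m a < toDRL m b ↔ a.degree < b.degree ∨
      (a.degree = b.degree ∧ ∃ i, (∀ j, i < j → a j = b j) ∧ b i < a i) := by
  have h : toDRL m a < toDRL m b ↔ key (toDRL m a) < key (toDRL m b) := Iff.rfl
  rw [h, key, key, Prod.Lex.toLex_lt_toLex]
  simp only [AddEquiv.symm_apply_apply, OrderDual.toDual_lt_toDual]
  refine or_congr Iff.rfl (and_congr Iff.rfl (exists_congr fun i => and_congr ?_ Iff.rfl))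
  exact forall_congr' fun j => imp_congr Iff.rfl eq_comm

theorem add_lt {m : ℕ} (a b c : Fin m →₀ ℕ) (h : toDRL m a < toDRL m b) :
    toDRL m (a + c) < toDRL m (b + c) := by
  rw [lt_iff] at h ⊢
  simpa using h

instance (m : ℕ) : IsOrderedAddMonoid (DegRevLex m) where
  add_le_add_left a b h c := by
    rcases h.eq_or_lt with rfl | h
    · exact le_rfl
    · exact (add_lt a b c h).le

theorem toDRL_monotone (m : ℕ) : Monotone (toDRL m) := by
  intro a b h
  rcases h.eq_or_lt with rfl | h
  · exact le_rfl
  · refine le_of_lt ((lt_iff a b).2 (Or.inl ?_))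
    obtain ⟨c, rfl⟩ := le_iff_exists_add.1 h.le
    have hc : c ≠ 0 := by
      rintro rfl
      simp at h
    have : c.degree ≠ 0 := fun h0 => hc ((Finsupp.degree_eq_zero_iff c).1 h0)
    rw [map_add]
    omega

instance (m : ℕ) : WellFoundedLT (DegRevLex m) := by
  have := (toDRL_monotone m).wellQuasiOrderedLE_of_wellQuasiOrderedLE_of_surjective (toDRL m).surjective
  infer_instance

end DegRevLex

/-- The degree reverse lexicographic order on `k[X 0, …, X (m-1)]` with
`X 0 > X 1 > ⋯ > X (m-1)`. -/
def degRevLex (m : ℕ) : MonomialOrder (Fin m) where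
  syn := DegRevLex m
  toSyn := DegRevLex.toDRL m
  toSyn_monotone := DegRevLex.toDRL_monotone m

/-! ### Initial ideals, Gröbner bases, minimal monomial generators -/

section

variable {σ k : Type*} [Field k]

/-- The leading monomials of the nonzero elements of a set of polynomials. -/
def leadMonomials (m : MonomialOrder σ) (F : Set (MvPolynomial σ k)) : Set (MvPolynomial σ k) :=
  {u | ∃ f ∈ F, f ≠ 0 ∧ u = monomial (m.degree f) 1}

/-- The initial ideal of `I`. -/
def initialIdeal (m : MonomialOrder σ) (I : Ideal (MvPolynomial σ k)) :
    Ideal (MvPolynomial σ k) :=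
  Ideal.span (leadMonomials m (I : Set (MvPolynomial σ k)))

/-- `G` is a Gröbner basis of `I`: a finite subset of `I` whose leading monomials generate
the initial ideal of `I`. -/
def IsGroebnerBasis (m : MonomialOrder σ) (G : Set (MvPolynomial σ k))
    (I : Ideal (MvPolynomial σ k)) : Prop :=
  G.Finite ∧ G ⊆ (I : Set (MvPolynomial σ k)) ∧
    Ideal.span (leadMonomials m G) = initialIdeal m I

/-- `S` is a set of monomials that generates `I`, and no proper subset of `S` generates `I`. -/
def IsMinimalMonomialGenerators (I : Ideal (MvPolynomial σ k))
    (S : Set (MvPolynomial σ k)) : Prop :=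
  (∀ u ∈ S, ∃ d : σ →₀ ℕ, u = monomial d 1) ∧ Ideal.span S = I ∧
    ∀ T : Set (MvPolynomial σ k), T ⊂ S → Ideal.span T ≠ I

/-- The defining ideal of the monomial curve with exponents `a`: the kernel of the
`k`-algebra map `x_i ↦ t ^ (a i)`. -/
def monomialCurveIdeal (k : Type*) [Field k] (a : σ → ℕ) : Ideal (MvPolynomial σ k) :=
  RingHom.ker (aeval fun i => (Polynomial.X : Polynomial k) ^ a i)

end

/-! ### Backelin's curves

The variables `x₁, x₂, x₃, x₄` are `X 0, X 1, X 2, X 3`. For `2 ≤ n` and `3 * n + 2 ≤ r` none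
of the subtractions of natural numbers below is truncated. -/

section

variable (k : Type*) [Field k] (n r : ℕ)

/-- The smallest exponent `s = r (3 n + 2) + 3`. -/
def s (n r : ℕ) : ℕ := r * (3 * n + 2) + 3

/-- The Backelin ideal, the defining ideal of the curve
`(t ^ s, t ^ (s + 3), t ^ (s + 3 n + 1), t ^ (s + 3 n + 2))`. -/
def P : Ideal (MvPolynomial (Fin 4) k) :=
  monomialCurveIdeal k ![s n r, s n r + 3, s n r + 3 * n + 1, s n r + 3 * n + 2]

def f1 : MvPolynomial (Fin 4) k := X 1 * X 2 ^ 3 - X 0 * X 3 ^ 3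

def f2 (i : ℕ) : MvPolynomial (Fin 4) k :=
  X 0 ^ (n - i) * X 2 ^ (3 * i - 1) - X 1 ^ (n - i + 1) * X 3 ^ (3 * i - 2)

def f3 (j : ℕ) : MvPolynomial (Fin 4) k :=
  X 0 ^ (r - n + 3 + j) * X 1 ^ (n - 1 - j) - X 2 ^ (2 + 3 * j) * X 3 ^ (r - 1 - 3 * j)

def f4 (j : ℕ) : MvPolynomial (Fin 4) k :=
  X 0 ^ (r - 2 * n + 3 + j) * X 1 ^ (2 * n - j) - X 2 ^ (3 * j + 1) * X 3 ^ (r + 1 - 3 * j)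

def f5 : MvPolynomial (Fin 4) k :=
  X 0 ^ (r - n + 2) * X 1 ^ n * X 2 - X 3 ^ (r + 2)

def f6 : MvPolynomial (Fin 4) k := X 1 ^ (n + 1) * X 2 - X 0 ^ n * X 3 ^ 2

def f7 : MvPolynomial (Fin 4) k := X 1 ^ (2 * n + 1) - X 0 ^ (2 * n - 1) * X 2 * X 3

def g : MvPolynomial (Fin 4) k := X 0 ^ (r + 2) - X 1 * X 3 ^ r

/-- The set of binomial generators of the Backelin ideal. -/
def gens : Set (MvPolynomial (Fin 4) k) :=
  {f1 k, f5 k n r, f6 k n, f7 k n} ∪ {f | ∃ i, 1 ≤ i ∧ i ≤ n ∧ f = f2 k n i} ∪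
    {f | ∃ j, j ≤ n - 1 ∧ f = f3 k n r j} ∪ {f | ∃ j, j ≤ n - 1 ∧ f = f4 k n r j}

/-- The generators with `f3 (n - 1)` replaced by `g`. -/
def G : Set (MvPolynomial (Fin 4) k) := (gens k n r \ {f3 k n r (n - 1)}) ∪ {g k r}

/-- The list of minimal generators of the initial ideal. -/
def initialGens : Set (MvPolynomial (Fin 4) k) :=
  {X 1 * X 2 ^ 3, X 0 ^ (r - n + 2) * X 1 ^ n * X 2, X 1 ^ (n + 1) * X 2, X 1 ^ (2 * n + 1)} ∪
    {u | ∃ i, 1 ≤ i ∧ i ≤ n ∧ u = X 0 ^ (n - i) * X 2 ^ (3 * i - 1)} ∪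
    {u | ∃ j, j ≤ n - 1 ∧ u = X 0 ^ (r - n + 3 + j) * X 1 ^ (n - 1 - j)} ∪
    {u | ∃ j, j ≤ n - 1 ∧ u = X 0 ^ (r - 2 * n + 3 + j) * X 1 ^ (2 * n - j)}

end

end Backelin

end

/-!
Only the zero polynomial of `P` has all its monomials outside the ideal generated by the leading
monomials of `G`, because those standard monomials have pairwise distinct weights. Indeed none of
the leading monomials involves `x₄`, so whether `x₁ ^ a * x₂ ^ b * x₃ ^ c * x₄ ^ d` is standard
depends on `a`, `b`, `c` alone. Its weight is `(s + 3 n + 2) (a + b + c + d) - ρ`, where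
`ρ = (3 n + 2) (a + b) - 3 b + c`. On standard monomials `0 ≤ ρ < s + 3 n + 2`, so the weight
determines both `ρ` and the degree, and `ρ` in turn determines `a + b`, then `(a, b, c)`.

Dividing an element of `P` by `G` leaves a remainder of that kind, which therefore vanishes; hence
`G` is a Gröbner basis. Its leading exponents form an antichain, which makes the leading monomials
the unique minimal generators of the initial ideal.
-/

noncomputable section

namespace Backelin

open MvPolynomial
open scoped MonomialOrder

section MonomialIdeals

variable {σ R : Type*} [CommSemiring R] [Nontrivial R]

theorem monomial_mem_span_monomial_image {E : Set (σ →₀ ℕ)} {d : σ →₀ ℕ} :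
    monomial d (1 : R) ∈ Ideal.span ((fun e => monomial e (1 : R)) '' E) ↔ d ∈ upperClosure E := by
  classical
  simp [mem_ideal_span_monomial_image, support_monomial]

theorem subset_of_span_monomial_image_eq {D E : Set (σ →₀ ℕ)} (hE : IsAntichain (· ≤ ·) E)
    (h : Ideal.span ((fun d => monomial d (1 : R)) '' D) =
      Ideal.span ((fun e => monomial e (1 : R)) '' E)) : E ⊆ D := by
  have hclosure : upperClosure D = upperClosure E := by
    ext d
    rw [SetLike.mem_coe, SetLike.mem_coe, ← monomial_mem_span_monomial_image (R := R), h,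
      monomial_mem_span_monomial_image]
  intro e he
  have hmin : Minimal (· ∈ upperClosure D) e := by
    rw [hclosure]
    exact hE.minimal_mem_upperClosure_iff_mem.2 he
  obtain ⟨d, hd, hde⟩ := mem_upperClosure.1 hmin.prop
  rwa [← hmin.eq_of_le (subset_upperClosure hd) hde]

theorem isMinimalMonomialGenerators_span_iff {k : Type*} [Field k] {E : Set (σ →₀ ℕ)}
    (hE : IsAntichain (· ≤ ·) E) {S : Set (MvPolynomial σ k)} :
    IsMinimalMonomialGenerators (Ideal.span ((fun e => monomial e (1 : k)) '' E)) S ↔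
      S = (fun e => monomial e (1 : k)) '' E := by
  constructor
  · rintro ⟨hmonomial, hspan, hminimal⟩
    obtain ⟨D, rfl⟩ : ∃ D, (fun d => monomial d (1 : k)) '' D = S :=
      Set.subset_range_iff_exists_image_eq.1 fun u hu => (hmonomial u hu).imp fun _ => Eq.symm
    have hED : (fun e => monomial e (1 : k)) '' E ⊆ (fun d => monomial d (1 : k)) '' D :=
      Set.image_mono (subset_of_span_monomial_image_eq hE hspan)
    by_contra hne
    exact hminimal _ (hED.ssubset_of_ne (Ne.symm hne)) rfl
  · rintro rfl
    refine ⟨?_, rfl, fun T hT hspan => ?_⟩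
    · rintro _ ⟨d, -, rfl⟩
      exact ⟨d, rfl⟩
    · obtain ⟨D, -, rfl⟩ := Set.subset_image_iff.1 hT.subset
      exact hT.not_subset (Set.image_mono (subset_of_span_monomial_image_eq hE hspan))

end MonomialIdeals

section LeadExponents

variable {σ R : Type*} [CommSemiring R]

/-- The exponents of the leading monomials of the nonzero elements of `F`. The standard exponents
of `F` are those outside the upper closure of this set. -/
def leadExponents (m : MonomialOrder σ) (F : Set (MvPolynomial σ R)) : Set (σ →₀ ℕ) :=
  m.degree '' (F \ {0})

theorem leadMonomials_eq_image_leadExponents {k : Type*} [Field k] (m : MonomialOrder σ)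
    (F : Set (MvPolynomial σ k)) :
    leadMonomials m F = (fun d => monomial d (1 : k)) '' leadExponents m F := by
  ext u
  simp [leadMonomials, leadExponents, and_assoc, eq_comm]

theorem leadExponents_mono (m : MonomialOrder σ) {F F' : Set (MvPolynomial σ R)} (h : F ⊆ F') :
    leadExponents m F ⊆ leadExponents m F' :=
  Set.image_mono (Set.sdiff_subset_sdiff_left h)

theorem leadExponents_exchange {m : MonomialOrder σ} {F : Set (MvPolynomial σ R)}
    {f g : MvPolynomial σ R} (hf : f ∈ F) (hf0 : f ≠ 0) (hg0 : g ≠ 0)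
    (hdeg : m.degree f = m.degree g) :
    leadExponents m ((F \ {f}) ∪ {g}) = leadExponents m F := by
  apply Set.Subset.antisymm
  · rintro _ ⟨p, ⟨⟨hp, -⟩ | rfl, hp0⟩, rfl⟩
    · exact ⟨p, ⟨hp, hp0⟩, rfl⟩
    · exact ⟨f, ⟨hf, hf0⟩, hdeg⟩
  · rintro _ ⟨p, ⟨hp, hp0⟩, rfl⟩
    by_cases hpf : p = f
    · exact ⟨g, ⟨.inr rfl, hg0⟩, by rw [hpf, hdeg]⟩
    · exact ⟨p, ⟨.inl ⟨hp, hpf⟩, hp0⟩, rfl⟩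

end LeadExponents

section GroebnerBases

variable {σ R : Type*} [CommSemiring R] [NoZeroDivisors R]

theorem degree_linearCombination_mem_upperClosure (m : MonomialOrder σ)
    {B : Set (MvPolynomial σ R)} (q : B →₀ MvPolynomial σ R)
    (hq : Finsupp.linearCombination _ (fun b : B => (b : MvPolynomial σ R)) q ≠ 0)
    (hdeg : ∀ b : B, m.degree ((b : MvPolynomial σ R) * q b) ≼[m]
      m.degree (Finsupp.linearCombination _ (fun b : B => (b : MvPolynomial σ R)) q)) :
    m.degree (Finsupp.linearCombination _ (fun b : B => (b : MvPolynomial σ R)) q) ∈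
      upperClosure (leadExponents m B) := by
  set h := Finsupp.linearCombination _ (fun b : B => (b : MvPolynomial σ R)) q
  obtain ⟨b, -, hb⟩ : ∃ b ∈ q.support, (q b * (b : MvPolynomial σ R)).coeff (m.degree h) ≠ 0 := by
    apply Finset.exists_ne_zero_of_sum_ne_zero
    rw [← coeff_sum]
    exact m.coeff_degree_ne_zero_iff.2 hq
  rw [mul_comm] at hb
  have hbq : (b : MvPolynomial σ R) * q b ≠ 0 := fun h0 => hb (by rw [h0, coeff_zero])
  have hdegree : m.degree h = m.degree (b : MvPolynomial σ R) + m.degree (q b) := by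
    rw [← m.degree_mul (left_ne_zero_of_mul hbq) (right_ne_zero_of_mul hbq)]
    exact m.toSyn.injective ((m.le_degree (mem_support_iff.2 hb)).antisymm (hdeg b))
  refine mem_upperClosure.2 ⟨_, ⟨b, ⟨b.2, left_ne_zero_of_mul hbq⟩, rfl⟩, ?_⟩
  exact hdegree ▸ le_self_add

theorem isGroebnerBasis_of_forall_eq_zero {k : Type*} [Field k] {m : MonomialOrder σ}
    {G : Set (MvPolynomial σ k)} {I : Ideal (MvPolynomial σ k)} (hfin : G.Finite)
    (hGI : G ⊆ (I : Set (MvPolynomial σ k)))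
    (hI : ∀ h ∈ I, Disjoint (h.support : Set (σ →₀ ℕ)) (upperClosure (leadExponents m G)) →
      h = 0) :
    IsGroebnerBasis m G I := by
  refine ⟨hfin, hGI, ?_⟩
  rw [initialIdeal, leadMonomials_eq_image_leadExponents, leadMonomials_eq_image_leadExponents]
  refine (Ideal.span_mono (Set.image_mono (leadExponents_mono m hGI))).antisymm
    (Ideal.span_le.2 ?_)
  rintro _ ⟨_, ⟨h, ⟨hh, hh0⟩, rfl⟩, rfl⟩
  refine monomial_mem_span_monomial_image.2 ?_
  obtain ⟨q, ρ, rfl, hdeg, hρ⟩ := m.div_set (B := G \ {0})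
    (fun b hb => (m.leadingCoeff_ne_zero_iff.2 hb.2).isUnit) h
  have hqI : Finsupp.linearCombination _ (fun b : ↥(G \ {0}) => (b : MvPolynomial σ k)) q ∈ I :=
    Ideal.sum_mem _ fun b _ => I.mul_mem_left _ (hGI b.2.1)
  have hρ0 : ρ = 0 := by
    refine hI ρ ((Ideal.add_mem_iff_right I hqI).1 hh) (Set.disjoint_left.2 fun c hc hcG => ?_)
    obtain ⟨_, ⟨b, hb, rfl⟩, hbc⟩ := mem_upperClosure.1 hcG
    exact hρ c hc b hb hbc
  subst hρ0
  rw [add_zero] at hh0 hdeg ⊢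
  simpa [leadExponents] using degree_linearCombination_mem_upperClosure m q hh0 hdeg

end GroebnerBases

section MonomialCurves

variable {σ k : Type*} [Field k] {a : σ → ℕ}

theorem aeval_X_pow_monomial (d : σ →₀ ℕ) (c : k) :
    aeval (fun i => (Polynomial.X : Polynomial k) ^ a i) (monomial d c) =
      Polynomial.monomial (Finsupp.weight a d) c := by
  simp only [aeval_monomial, Finsupp.prod, ← pow_mul', Finset.prod_pow_eq_pow_sum,
    Polynomial.algebraMap_eq, Polynomial.C_mul_X_pow_eq_monomial, Finsupp.weight_apply,
    Finsupp.sum, smul_eq_mul]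

theorem eq_zero_of_mem_monomialCurveIdeal {h : MvPolynomial σ k}
    (hh : h ∈ monomialCurveIdeal k a)
    (hinj : Set.InjOn (Finsupp.weight a) (h.support : Set (σ →₀ ℕ))) : h = 0 := by
  by_contra hne
  obtain ⟨d, hd⟩ := support_nonempty.2 hne
  have hcoeff : (aeval (fun i => (Polynomial.X : Polynomial k) ^ a i) h).coeff
      (Finsupp.weight a d) = h.coeff d := by
    conv_lhs => rw [h.as_sum]
    simp only [map_sum, aeval_X_pow_monomial, Polynomial.finsetSum_coeff,
      Polynomial.coeff_monomial]
    rw [Finset.sum_eq_single_of_mem d hd fun e he hed => if_neg fun hw => hed (hinj he hd hw),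
      if_pos rfl]
  rw [RingHom.mem_ker.1 hh, Polynomial.coeff_zero] at hcoeff
  exact mem_support_iff.1 hd hcoeff.symm

theorem isGroebnerBasis_monomialCurveIdeal {m : MonomialOrder σ} {G : Set (MvPolynomial σ k)}
    (hfin : G.Finite) (hG : G ⊆ (monomialCurveIdeal k a : Set (MvPolynomial σ k)))
    (hinj : Set.InjOn (Finsupp.weight a) (upperClosure (leadExponents m G) : Set (σ →₀ ℕ))ᶜ) :
    IsGroebnerBasis m G (monomialCurveIdeal k a) :=
  isGroebnerBasis_of_forall_eq_zero hfin hG fun _ hh hstandard =>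
    eq_zero_of_mem_monomialCurveIdeal hh (hinj.mono hstandard.subset_compl_right)

end MonomialCurves

section PureBinomials

variable {σ R : Type*} [CommRing R]

variable (R) in
/-- The difference of the monomials with exponents `u` and `v`; all the generators of the
Backelin ideal have this form. -/
def pureBinomial (u v : σ →₀ ℕ) : MvPolynomial σ R :=
  monomial u 1 - monomial v 1

theorem pureBinomial_mem_monomialCurveIdeal_iff {k : Type*} [Field k] {a : σ → ℕ}
    {u v : σ →₀ ℕ} : pureBinomial k u v ∈ monomialCurveIdeal k a ↔
      Finsupp.weight a u = Finsupp.weight a v := by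
  rw [monomialCurveIdeal, RingHom.mem_ker, pureBinomial, map_sub, aeval_X_pow_monomial,
    aeval_X_pow_monomial, sub_eq_zero, Polynomial.monomial_left_inj one_ne_zero]

variable [Nontrivial R] {m : MonomialOrder σ} {u v : σ →₀ ℕ}

theorem degree_pureBinomial (h : v ≺[m] u) : m.degree (pureBinomial R u v) = u := by
  classical
  have hdegree (d : σ →₀ ℕ) : m.degree (monomial d (1 : R)) = d := by
    rw [m.degree_monomial, if_neg one_ne_zero]
  rw [pureBinomial, m.degree_sub_of_lt (by rwa [hdegree, hdegree]), hdegree]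

theorem pureBinomial_ne_zero (h : u ≠ v) : pureBinomial R u v ≠ 0 :=
  sub_ne_zero.2 fun huv => h (monomial_left_injective one_ne_zero huv)

theorem leadExponents_range_pureBinomial {ι : Type*} {u v : ι → σ →₀ ℕ}
    (h : ∀ x, v x ≺[m] u x) :
    leadExponents m (Set.range fun x => pureBinomial R (u x) (v x)) = Set.range u := by
  have hne : (0 : MvPolynomial σ R) ∉ Set.range fun x => pureBinomial R (u x) (v x) := by
    rintro ⟨x, hx⟩
    exact pureBinomial_ne_zero (fun huv => (h x).ne (by rw [huv])) hx
  rw [leadExponents, Set.sdiff_singleton_eq_self hne, ← Set.range_comp]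
  exact congrArg Set.range (funext fun x => degree_pureBinomial (h x))

end PureBinomials

theorem degRevLex_lt_of_last_lt {m : ℕ} {u v : Fin (m + 1) →₀ ℕ}
    (h : v.degree < u.degree ∨ v.degree = u.degree ∧ u (Fin.last m) < v (Fin.last m)) :
    v ≺[degRevLex (m + 1)] u :=
  (DegRevLex.lt_iff v u).2 <| h.imp_right <| And.imp_right fun hlast =>
    ⟨Fin.last m, fun j hj => absurd hj (Fin.le_last j).not_gt, hlast⟩


section BackelinCurve

/-- The exponents of the Backelin curve. -/
def curveExponents (n r : ℕ) : Fin 4 → ℕ :=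
  ![s n r, s n r + 3, s n r + 3 * n + 1, s n r + 3 * n + 2]

/-- The exponent vector of `x₁ ^ a * x₂ ^ b * x₃ ^ c * x₄ ^ d`. -/
def expVec (a b c d : ℕ) : Fin 4 →₀ ℕ := Finsupp.equivFunOnFinite.symm ![a, b, c, d]

@[simp] theorem expVec_zero (a b c d : ℕ) : expVec a b c d 0 = a := rfl
@[simp] theorem expVec_one (a b c d : ℕ) : expVec a b c d 1 = b := rfl
@[simp] theorem expVec_two (a b c d : ℕ) : expVec a b c d 2 = c := rfl
@[simp] theorem expVec_three (a b c d : ℕ) : expVec a b c d 3 = d := rfl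

theorem expVec_le_iff {a b c d : ℕ} {u : Fin 4 →₀ ℕ} :
    expVec a b c d ≤ u ↔ a ≤ u 0 ∧ b ≤ u 1 ∧ c ≤ u 2 ∧ d ≤ u 3 := by
  simp [Finsupp.le_def, Fin.forall_fin_succ]

theorem monomial_expVec (R : Type*) [CommSemiring R] (a b c d : ℕ) :
    monomial (expVec a b c d) (1 : R) = X 0 ^ a * X 1 ^ b * X 2 ^ c * X 3 ^ d := by
  rw [monomial_eq, map_one, one_mul, Finsupp.prod_fintype _ _ (by simp), Fin.prod_univ_four]
  rfl

theorem degree_fin_four (u : Fin 4 →₀ ℕ) : u.degree = u 0 + u 1 + u 2 + u 3 := by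
  rw [Finsupp.degree_eq_sum, Fin.sum_univ_four]

theorem weight_curveExponents (n r : ℕ) (u : Fin 4 →₀ ℕ) :
    Finsupp.weight (curveExponents n r) u =
      u 0 * s n r + u 1 * (s n r + 3) + u 2 * (s n r + 3 * n + 1) +
        u 3 * (s n r + 3 * n + 2) := by
  rw [Finsupp.weight_eq_sum, Fin.sum_univ_four]
  rfl

/-- The labels of the elements of `gens k n r`. Here `f2 i` stands for the binomial written
`f2 k n (i + 1)`, since the index of this family starts at `1`. -/
inductive GeneratorLabel (n : ℕ)
  | f1
  | f2 (i : Fin n)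
  | f3 (j : Fin n)
  | f4 (j : Fin n)
  | f5
  | f6
  | f7
  deriving Fintype

variable {n r : ℕ}

/-- The exponent vector of the leading monomial of a generator. -/
def leadExponent (r : ℕ) : GeneratorLabel n → Fin 4 →₀ ℕ
  | .f1 => expVec 0 1 3 0
  | .f2 i => expVec (n - (i + 1)) 0 (3 * (i + 1) - 1) 0
  | .f3 j => expVec (r - n + 3 + j) (n - 1 - j) 0 0
  | .f4 j => expVec (r - 2 * n + 3 + j) (2 * n - j) 0 0
  | .f5 => expVec (r - n + 2) n 1 0
  | .f6 => expVec 0 (n + 1) 1 0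
  | .f7 => expVec 0 (2 * n + 1) 0 0

/-- The exponent vector of the other monomial of a generator. -/
def tailExponent (r : ℕ) : GeneratorLabel n → Fin 4 →₀ ℕ
  | .f1 => expVec 1 0 0 3
  | .f2 i => expVec 0 (n - (i + 1) + 1) 0 (3 * (i + 1) - 2)
  | .f3 j => expVec 0 0 (2 + 3 * j) (r - 1 - 3 * j)
  | .f4 j => expVec 0 0 (3 * j + 1) (r + 1 - 3 * j)
  | .f5 => expVec 0 0 0 (r + 2)
  | .f6 => expVec n 0 0 2
  | .f7 => expVec (2 * n - 1) 0 1 1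

theorem range_generatorLabel {α : Type*} (hn : 0 < n) {F : GeneratorLabel n → α}
    {F₂ F₃ F₄ : ℕ → α} (h₂ : ∀ i, F (.f2 i) = F₂ (i + 1)) (h₃ : ∀ j, F (.f3 j) = F₃ j)
    (h₄ : ∀ j, F (.f4 j) = F₄ j) :
    Set.range F = {F .f1, F .f5, F .f6, F .f7} ∪ {y | ∃ i, 1 ≤ i ∧ i ≤ n ∧ y = F₂ i} ∪
      {y | ∃ j, j ≤ n - 1 ∧ y = F₃ j} ∪ {y | ∃ j, j ≤ n - 1 ∧ y = F₄ j} := by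
  apply Set.Subset.antisymm
  · rintro _ ⟨_ | i | j | j | _ | _ | _, rfl⟩
    · exact .inl (.inl (.inl (.inl rfl)))
    · exact .inl (.inl (.inr ⟨i + 1, i.1.succ_pos, i.2, h₂ i⟩))
    · exact .inl (.inr ⟨j, Nat.le_sub_one_of_lt j.2, h₃ j⟩)
    · exact .inr ⟨j, Nat.le_sub_one_of_lt j.2, h₄ j⟩
    · exact .inl (.inl (.inl (.inr (.inl rfl))))
    · exact .inl (.inl (.inl (.inr (.inr (.inl rfl)))))
    · exact .inl (.inl (.inl (.inr (.inr (.inr rfl)))))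
  · rintro _ ((((rfl | rfl | rfl | rfl) | ⟨_ | i, h1, hi, rfl⟩) | ⟨j, hj, rfl⟩) | ⟨j, hj, rfl⟩)
    · exact ⟨.f1, rfl⟩
    · exact ⟨.f5, rfl⟩
    · exact ⟨.f6, rfl⟩
    · exact ⟨.f7, rfl⟩
    · exact absurd h1 (Nat.not_succ_le_zero 0)
    · exact ⟨.f2 ⟨i, hi⟩, h₂ _⟩
    · exact ⟨.f3 ⟨j, Nat.lt_of_le_sub_one hn hj⟩, h₃ _⟩
    · exact ⟨.f4 ⟨j, Nat.lt_of_le_sub_one hn hj⟩, h₄ _⟩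

theorem gens_eq_range (k : Type*) [Field k] (hn : 0 < n) : gens k n r =
    Set.range fun x : GeneratorLabel n =>
      pureBinomial k (leadExponent r x) (tailExponent r x) := by
  rw [range_generatorLabel hn (F₂ := f2 k n) (F₃ := f3 k n r) (F₄ := f4 k n r)]
  · simp [gens, f1, f5, f6, f7, pureBinomial, leadExponent, tailExponent, monomial_expVec]
  all_goals simp [f2, f3, f4, pureBinomial, leadExponent, tailExponent, monomial_expVec]

theorem initialGens_eq_range (k : Type*) [Field k] (hn : 0 < n) : initialGens k n r =
    Set.range fun x : GeneratorLabel n => monomial (leadExponent r x) (1 : k) := by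
  rw [range_generatorLabel hn (F₂ := fun i => X 0 ^ (n - i) * X 2 ^ (3 * i - 1))
    (F₃ := fun j => X 0 ^ (r - n + 3 + j) * X 1 ^ (n - 1 - j))
    (F₄ := fun j => X 0 ^ (r - 2 * n + 3 + j) * X 1 ^ (2 * n - j))]
  · simp [initialGens, leadExponent, monomial_expVec]
  all_goals simp [leadExponent, monomial_expVec]

theorem leadExponent_three (x : GeneratorLabel n) : leadExponent r x 3 = 0 := by
  cases x <;> rfl

theorem tailExponent_lt_leadExponent (hn : 2 ≤ n) (hr : 3 * n ≤ r + 2) (x : GeneratorLabel n) :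
    tailExponent r x ≺[degRevLex 4] leadExponent r x := by
  apply degRevLex_lt_of_last_lt
  change _ ∨ _ ∧ leadExponent r x 3 < tailExponent r x 3
  rw [degree_fin_four, degree_fin_four]
  rcases x with _ | i | j | j | _ | _ | _ <;>
    simp only [leadExponent, tailExponent, expVec_zero, expVec_one, expVec_two, expVec_three,
      true_and] <;>
    omega

theorem weight_tailExponent (hn : 2 ≤ n) (hr : 3 * n ≤ r + 2) (x : GeneratorLabel n) :
    Finsupp.weight (curveExponents n r) (tailExponent r x) =
      Finsupp.weight (curveExponents n r) (leadExponent r x) := by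
  rw [weight_curveExponents, weight_curveExponents]
  rcases x with _ | ⟨i, hi⟩ | ⟨j, hj⟩ | ⟨j, hj⟩ | _ | _ | _ <;>
    simp only [leadExponent, tailExponent, expVec_zero, expVec_one, expVec_two, expVec_three]
  · ring
  · obtain ⟨p, rfl⟩ := Nat.exists_eq_add_of_lt hi
    rw [show i + p + 1 - (i + 1) = p by omega, show 3 * (i + 1) - 1 = 3 * i + 2 by omega,
      show 3 * (i + 1) - 2 = 3 * i + 1 by omega]
    ring
  · obtain ⟨p, rfl⟩ := Nat.exists_eq_add_of_lt hj
    obtain ⟨q, rfl⟩ : ∃ q, r = 3 * (j + p) + 1 + q := Nat.exists_eq_add_of_le (by omega)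
    rw [show 3 * (j + p) + 1 + q - (j + p + 1) + 3 + j = 3 * j + 2 * p + q + 3 by omega,
      show j + p + 1 - 1 - j = p by omega,
      show 3 * (j + p) + 1 + q - 1 - 3 * j = 3 * p + q by omega, s]
    ring
  · obtain ⟨p, rfl⟩ := Nat.exists_eq_add_of_lt hj
    obtain ⟨q, rfl⟩ : ∃ q, r = 3 * (j + p) + 1 + q := Nat.exists_eq_add_of_le (by omega)
    rw [show 3 * (j + p) + 1 + q - 2 * (j + p + 1) + 3 + j = 2 * j + p + q + 2 by omega,
      show 2 * (j + p + 1) - j = j + 2 * p + 2 by omega,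
      show 3 * (j + p) + 1 + q + 1 - 3 * j = 3 * p + q + 2 by omega, s]
    ring
  · obtain ⟨p, hp⟩ : ∃ p, r + 2 = n + p := Nat.exists_eq_add_of_le (by omega)
    rw [show r - n + 2 = p by omega, s]
    linear_combination (r * (3 * n + 2) + 3) * hp
  · ring
  · obtain ⟨p, rfl⟩ := Nat.exists_eq_add_of_le' hn
    rw [show 2 * (p + 2) - 1 = 2 * p + 3 by omega]
    ring

theorem eq_of_leadExponent_le (hn : 2 ≤ n) (hr : 3 * n ≤ r + 2) {x y : GeneratorLabel n}
    (h : leadExponent r x ≤ leadExponent r y) : x = y := by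
  rcases x with _ | i | j | j | _ | _ | _ <;> rcases y with _ | i' | j' | j' | _ | _ | _ <;>
    simp only [leadExponent, expVec_le_iff, expVec_zero, expVec_one, expVec_two,
      GeneratorLabel.f2.injEq, GeneratorLabel.f3.injEq, GeneratorLabel.f4.injEq,
      Fin.ext_iff] at h ⊢ <;>
    omega

theorem isAntichain_range_leadExponent (hn : 2 ≤ n) (hr : 3 * n ≤ r + 2) :
    IsAntichain (· ≤ ·) (Set.range (leadExponent (n := n) r)) := by
  rintro _ ⟨x, rfl⟩ _ ⟨y, rfl⟩ hne hle
  exact hne (congrArg _ (eq_of_leadExponent_le hn hr hle))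

theorem leadExponents_gens (k : Type*) [Field k] (hn : 2 ≤ n) (hr : 3 * n ≤ r + 2) :
    leadExponents (degRevLex 4) (gens k n r) = Set.range (leadExponent (n := n) r) := by
  rw [gens_eq_range k (by omega)]
  exact leadExponents_range_pureBinomial (tailExponent_lt_leadExponent hn hr)

theorem gens_subset_P (k : Type*) [Field k] (hn : 2 ≤ n) (hr : 3 * n ≤ r + 2) :
    gens k n r ⊆ (P k n r : Set (MvPolynomial (Fin 4) k)) := by
  rw [gens_eq_range k (by omega)]
  rintro _ ⟨x, rfl⟩
  exact pureBinomial_mem_monomialCurveIdeal_iff.2 (weight_tailExponent hn hr x).symm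

theorem g_eq_pureBinomial (k : Type*) [Field k] (r : ℕ) :
    g k r = pureBinomial k (expVec (r + 2) 0 0 0) (expVec 0 1 0 r) := by
  simp [g, pureBinomial, monomial_expVec]

theorem g_mem_P (k : Type*) [Field k] (n r : ℕ) : g k r ∈ P k n r := by
  rw [g_eq_pureBinomial]
  refine pureBinomial_mem_monomialCurveIdeal_iff.2 ?_
  change Finsupp.weight (curveExponents n r) _ = Finsupp.weight (curveExponents n r) _
  simp only [weight_curveExponents, expVec_zero, expVec_one, expVec_two, expVec_three, s]
  ring

theorem expVec_tail_g_lt (r : ℕ) : expVec 0 1 0 r ≺[degRevLex 4] expVec (r + 2) 0 0 0 :=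
  degRevLex_lt_of_last_lt (.inl (by simp [degree_fin_four, add_comm]))

theorem leadExponents_G (k : Type*) [Field k] (hn : 2 ≤ n) (hr : 3 * n ≤ r + 2) :
    leadExponents (degRevLex 4) (G k n r) = Set.range (leadExponent (n := n) r) := by
  let x : GeneratorLabel n := .f3 ⟨n - 1, by omega⟩
  have hx : f3 k n r (n - 1) = pureBinomial k (leadExponent r x) (tailExponent r x) := by
    simp [f3, pureBinomial, x, leadExponent, tailExponent, monomial_expVec]
  have hlt := tailExponent_lt_leadExponent hn hr x
  have hlead : leadExponent r x = expVec (r + 2) 0 0 0 := by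
    simp only [x, leadExponent]
    congr 1 <;> omega
  rw [← leadExponents_gens k hn hr, G]
  apply leadExponents_exchange
  · rw [hx, gens_eq_range k (by omega)]
    exact ⟨x, rfl⟩
  · rw [hx]
    exact pureBinomial_ne_zero fun h => hlt.ne (by rw [h])
  · rw [g_eq_pureBinomial]
    exact pureBinomial_ne_zero fun h => (expVec_tail_g_lt r).ne (by rw [h])
  · rw [hx, g_eq_pureBinomial, degree_pureBinomial hlt, degree_pureBinomial (expVec_tail_g_lt r),
      hlead]

theorem finite_G (k : Type*) [Field k] (hn : 0 < n) : (G k n r).Finite := by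
  rw [G, gens_eq_range k hn]
  exact ((Set.finite_range _).subset Set.sdiff_subset).union (Set.finite_singleton _)

theorem G_subset_P (k : Type*) [Field k] (hn : 2 ≤ n) (hr : 3 * n ≤ r + 2) :
    G k n r ⊆ (P k n r : Set (MvPolynomial (Fin 4) k)) :=
  Set.union_subset (Set.sdiff_subset.trans (gens_subset_P k hn hr))
    (Set.singleton_subset_iff.2 (g_mem_P k n r))

/-- The inequalities satisfied by the exponents `u` of the standard monomials, those divisible by no
leading monomial of a generator. They constrain only `u 0`, `u 1` and `u 2`, since no leading
monomial involves `x₄`. -/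
structure IsStandard (n r : ℕ) (u : Fin 4 →₀ ℕ) : Prop where
  x₃_lt_or_x₂_eq_zero : u 2 < 3 ∨ u 1 = 0
  three_mul_x₁_add_x₃_lt : 2 ≤ u 2 → 3 * u 0 + u 2 + 1 < 3 * n
  x₁_add_x₂_le : u 0 + u 1 ≤ r + 2
  x₁_add_x₂_le_of_x₂_lt : u 1 < n → u 0 + u 1 ≤ r + 1
  x₁_add_x₂_le_of_x₃_pos : 0 < u 2 → u 0 + u 1 ≤ r + 1
  x₂_le_of_x₃_pos : 0 < u 2 → u 1 ≤ n
  x₂_le : u 1 ≤ 2 * n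

theorem isStandard_of_forall_not_le (hn : 2 ≤ n) (hr : 3 * n ≤ r + 2) {u : Fin 4 →₀ ℕ}
    (hu : ∀ x : GeneratorLabel n, ¬ leadExponent r x ≤ u) : IsStandard n r u := by
  have h1 := hu .f1
  have h2 (i : Fin n) := hu (.f2 i)
  have h3 (j : Fin n) := hu (.f3 j)
  have h4 (j : Fin n) := hu (.f4 j)
  have h5 := hu .f5
  have h6 := hu .f6
  have h7 := hu .f7
  simp only [leadExponent, expVec_le_iff, Fin.forall_iff] at h1 h2 h3 h4 h5 h6 h7
  have hadd_of_lt (hb : u 1 < n) : u 0 + u 1 ≤ r + 1 := by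
    have := h3 (n - 1 - u 1) (by omega)
    omega
  refine ⟨by omega, fun hc => ?_, ?_, hadd_of_lt, fun hc => ?_, by omega, by omega⟩
  · by_contra! hge
    by_cases hlt : u 2 + 1 < 3 * n
    · have := h2 ((u 2 + 1) / 3 - 1) (by omega)
      omega
    · have := h2 (n - 1) (by omega)
      omega
  · rcases lt_trichotomy (u 1) n with hlt | heq | hgt
    · exact (hadd_of_lt hlt).trans (Nat.le_succ _)
    · have := h3 0 (by omega)
      omega
    · have := h4 (2 * n - u 1) (by omega)
      omega
  · rcases lt_or_ge (u 1) n with hlt | hge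
    · exact hadd_of_lt hlt
    · omega

/-- The negative of the weight of `u` modulo the largest exponent `s + 3 n + 2` of the curve: the
exponents of `x₁, x₂, x₃, x₄` fall short of it by `3 n + 2`, `3 n - 1`, `1` and `0`. -/
def residue (n : ℕ) (u : Fin 4 →₀ ℕ) : ℕ := (3 * n + 2) * u 0 + (3 * n - 1) * u 1 + u 2

theorem weight_add_residue (hn : 0 < n) (r : ℕ) (u : Fin 4 →₀ ℕ) :
    Finsupp.weight (curveExponents n r) u + residue n u = (s n r + 3 * n + 2) * u.degree := by
  obtain ⟨p, rfl⟩ := Nat.exists_eq_add_of_le' hn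
  rw [weight_curveExponents, residue, degree_fin_four, show 3 * (p + 1) - 1 = 3 * p + 2 by omega]
  ring

theorem residue_add (hn : 0 < n) (u : Fin 4 →₀ ℕ) :
    residue n u + 3 * u 1 = (3 * n + 2) * (u 0 + u 1) + u 2 := by
  obtain ⟨p, rfl⟩ := Nat.exists_eq_add_of_le' hn
  rw [residue, show 3 * (p + 1) - 1 = 3 * p + 2 by omega]
  ring

theorem residue_lt (hn : 0 < n) (hr : 3 * n ≤ r + 2) {u : Fin 4 →₀ ℕ} (hu : IsStandard n r u) :
    residue n u < s n r + 3 * n + 2 := by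
  have hs : s n r + 3 * n + 2 = (3 * n + 2) * (r + 1) + 3 := by rw [s]; ring
  have hres := residue_add hn u
  obtain ⟨-, hc2, hadd, haddb, haddc, hbc, -⟩ := hu
  rcases hadd.eq_or_lt with h | h
  · rw [h, show r + 2 = (r + 1) + 1 from rfl, mul_add] at hres
    omega
  · rcases Nat.lt_or_ge (u 2) 2 with hc | hc
    · have := Nat.mul_le_mul_left (3 * n + 2) (Nat.le_of_lt_succ h)
      omega
    · have hle : u 0 + u 1 ≤ r := by omega
      have := Nat.mul_le_mul_left (3 * n + 2) hle
      rw [hs, mul_add]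
      omega

theorem residue_ne_of_add_lt (hn : 0 < n) {u v : Fin 4 →₀ ℕ} (hu : IsStandard n r u)
    (hv : IsStandard n r v) (h : u 0 + u 1 < v 0 + v 1) : residue n u ≠ residue n v := by
  intro heq
  obtain ⟨δ, hδ⟩ := Nat.exists_eq_add_of_lt h
  have hdiff : (3 * n + 2) * δ + 3 * n + 2 + 3 * u 1 + v 2 = 3 * v 1 + u 2 := by
    have hresu := residue_add hn u
    have hresv := residue_add hn v
    rw [hδ, add_assoc, mul_add, mul_add_one] at hresv
    omega
  rcases Nat.lt_or_ge (u 2) 2 with hc | hc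
  · have hδ0 : δ = 0 := by
      by_contra hδ0
      have := Nat.le_mul_of_pos_right (3 * n + 2) (Nat.pos_of_ne_zero hδ0)
      have := hv.x₂_le
      omega
    subst hδ0
    have := hv.x₂_le_of_x₃_pos
    omega
  · have := hu.three_mul_x₁_add_x₃_lt hc
    have := Nat.mul_le_mul_right δ (show 3 ≤ 3 * n + 2 by omega)
    omega

theorem eq_of_residue_eq (hn : 0 < n) {u v : Fin 4 →₀ ℕ} (hu : IsStandard n r u)
    (hv : IsStandard n r v) (h : residue n u = residue n v) :
    u 0 = v 0 ∧ u 1 = v 1 ∧ u 2 = v 2 := by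
  have hadd : u 0 + u 1 = v 0 + v 1 := by
    rcases lt_trichotomy (u 0 + u 1) (v 0 + v 1) with hlt | heq | hgt
    · exact absurd h (residue_ne_of_add_lt hn hu hv hlt)
    · exact heq
    · exact absurd h.symm (residue_ne_of_add_lt hn hv hu hgt)
  have hresu := residue_add hn u
  have hresv := residue_add hn v
  rw [hadd] at hresu
  have hu3 := hu.x₃_lt_or_x₂_eq_zero
  have hv3 := hv.x₃_lt_or_x₂_eq_zero
  omega

theorem injOn_weight_isStandard (hn : 0 < n) (hr : 3 * n ≤ r + 2) :
    Set.InjOn (Finsupp.weight (curveExponents n r)) {u | IsStandard n r u} := by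
  intro u hu v hv hw
  have hwu := weight_add_residue hn r u
  have hwv := weight_add_residue hn r v
  set N := s n r + 3 * n + 2
  have hmul : N * u.degree + residue n v = N * v.degree + residue n u := by omega
  have hres : residue n u = residue n v := by
    have hmod : residue n u % N = residue n v % N := by
      rw [← Nat.mul_add_mod N v.degree, ← hmul, Nat.mul_add_mod]
    rwa [Nat.mod_eq_of_lt (residue_lt hn hr hu), Nat.mod_eq_of_lt (residue_lt hn hr hv)] at hmod
  have hdegree : u.degree = v.degree := by
    rw [hres, Nat.add_right_cancel_iff] at hmul
    exact Nat.eq_of_mul_eq_mul_left (Nat.succ_pos _) hmul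
  obtain ⟨h0, h1, h2⟩ := eq_of_residue_eq hn hu hv hres
  rw [degree_fin_four, degree_fin_four] at hdegree
  ext i
  fin_cases i
  exacts [h0, h1, h2, show u 3 = v 3 by omega]

theorem isGroebnerBasis_G (k : Type*) [Field k] (hn : 2 ≤ n) (hr : 3 * n ≤ r + 2) :
    IsGroebnerBasis (degRevLex 4) (G k n r) (P k n r) := by
  refine isGroebnerBasis_monomialCurveIdeal (finite_G k (by omega)) (G_subset_P k hn hr)
    ((injOn_weight_isStandard (n := n) (by omega) hr).mono fun u hu => ?_)
  rw [leadExponents_G k hn hr] at hu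
  exact isStandard_of_forall_not_le hn hr fun x hx => hu (mem_upperClosure.2 ⟨_, ⟨x, rfl⟩, hx⟩)

theorem initialIdeal_P (k : Type*) [Field k] (hn : 2 ≤ n) (hr : 3 * n ≤ r + 2) :
    initialIdeal (degRevLex 4) (P k n r) =
      Ideal.span ((fun d => monomial d (1 : k)) '' Set.range (leadExponent (n := n) r)) := by
  rw [← (isGroebnerBasis_G k hn hr).2.2, leadMonomials_eq_image_leadExponents,
    leadExponents_G k hn hr]

theorem initialGens_eq_image (k : Type*) [Field k] (hn : 0 < n) :
    initialGens k n r = (fun d => monomial d (1 : k)) '' Set.range (leadExponent (n := n) r) := by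
  rw [initialGens_eq_range k hn, ← Set.range_comp]
  rfl

theorem not_X_three_dvd_of_mem_initialGens {k : Type*} [Field k] (hn : 0 < n)
    {u : MvPolynomial (Fin 4) k} (hu : u ∈ initialGens k n r) :
    ¬ (X 3 : MvPolynomial (Fin 4) k) ∣ u := by
  rw [initialGens_eq_range k hn] at hu
  obtain ⟨x, rfl⟩ := hu
  simp [X_dvd_monomial, leadExponent_three]

end BackelinCurve

end Backelin

end

theorem mainTheorem5_general {k : Type*} [Field k] (n r : ℕ) (hn : 2 ≤ n) (hr : 3 * n ≤ r + 2) :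
    Backelin.IsGroebnerBasis (Backelin.degRevLex 4) (Backelin.G k n r) (Backelin.P k n r) ∧
    (∀ S : Set (MvPolynomial (Fin 4) k),
      Backelin.IsMinimalMonomialGenerators
        (Backelin.initialIdeal (Backelin.degRevLex 4) (Backelin.P k n r)) S ↔
      S = Backelin.initialGens k n r) ∧
    ∀ u ∈ Backelin.initialGens k n r, ¬ (MvPolynomial.X 3 : MvPolynomial (Fin 4) k) ∣ u := by
  have hn0 : 0 < n := by omega
  refine ⟨Backelin.isGroebnerBasis_G k hn hr, fun S => ?_,
    fun u hu => Backelin.not_X_three_dvd_of_mem_initialGens hn0 hu⟩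
  rw [Backelin.initialIdeal_P k hn hr, Backelin.initialGens_eq_image k hn0]
  exact Backelin.isMinimalMonomialGenerators_span_iff
    (Backelin.isAntichain_range_leadExponent hn hr)

theorem mainTheorem5 {k : Type*} [Field k] (n r : ℕ) (hn : 2 ≤ n) (hr : 3 * n + 2 ≤ r) :
    Backelin.IsGroebnerBasis (Backelin.degRevLex 4) (Backelin.G k n r) (Backelin.P k n r) ∧
    (∀ S : Set (MvPolynomial (Fin 4) k),
      Backelin.IsMinimalMonomialGenerators
        (Backelin.initialIdeal (Backelin.degRevLex 4) (Backelin.P k n r)) S ↔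
      S = Backelin.initialGens k n r) ∧
    ∀ u ∈ Backelin.initialGens k n r, ¬ (MvPolynomial.X 3 : MvPolynomial (Fin 4) k) ∣ u :=
  mainTheorem5_general n r hn (by omega)
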